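/- Let $k$ be a field and let $H$ be a finite-dimensional Hopf algebra over $k$ which is quasitriangular with R-matrix $R=\sum R^{(1)}\otimes R^{(2)}\in H\otimes H$; that is, $R$ is invertible, $\tau(\Delta(h))R=R\Delta(h)$ for all $h\in H$, $(\Delta\otimes\mathrm{id})(R)=R_{13}R_{23}$ and $(\mathrm{id}\otimes\Delta)(R)=R_{13}R_{12}$, where $\tau$ is the flip. Let $H^*$ be the dual Hopf algebra, with product $\langle fg,x\rangle=\sum\langle f,x_{(1)}\rangle\langle g,x_{(2)}\rangle$ and coproduct determined by $\langle f,xy\rangle=\sum\langle f_{(1)},x\rangle\langle f_{(2)},y\rangle$. Let $C=\sum C^{(1)}\otimes C^{(2)}\in H\otimes H$ be a cocycle for $H^*$; that is, $C$ is invertible and the functional $\sigma(f\otimes g)=\sum\langle f,C^{(1)}\rangle\langle g,C^{(2)}\rangle$ on $H^*\otimes H^*$ (which is then convolution invertible) satisfies $\sigma(f\otimes 1)=\sigma(1\otimes f)=\varepsilon(f)$ and $$\sum\sigma(g_{(1)}\otimes l_{(1)})\,\sigma(f\otimes g_{(2)}l_{(2)})=\sum\sigma(f_{(1)}\otimes g_{(1)})\,\sigma(f_{(2)}g_{(2)}\otimes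 l)$$ for all $f,g,l\in H^*$. Let ${}_CH^*=k\#_CH^*$ be the vector space $H^*$ with the product $f\cdot g=\sum\sigma(f_{(1)}\otimes g_{(1)})f_{(2)}g_{(2)}$, and let $H$ act on it by $h\rightharpoonup f=\sum f_{(1)}\langle f_{(2)},h\rangle$; this is an $H$-module algebra. Put $R_C=\tau(C)\,R\,C^{-1}=\sum R_C^{(1)}\otimes R_C^{(2)}$. An $H$-module algebra $A$ is called $(H,R)$-Azumaya if the two canonical $H$-module algebra maps $$F\colon A\#\overline A\to\mathrm{End}_k(A),\quad F(a\#\bar b)(c)=\sum a\,(R^{(2)}\cdot c)(R^{(1)}\cdot b),$$ $$G\colon\overline A\# A\to\mathrm{End}_k(A)^{op},\quad G(\bar a\# b)(c)=\sum(R^{(2)}\cdot a)(R^{(1)}\cdot c)\,b$$ are isomorphisms (equivalently, bijective). Here $\overline A$ is the $H$-module $A$ with product $a\circ b=\sum(R^{(2)}\cdot b)(R^{(1)}\cdot a)$, and, for $H$-module algebras $A,B$, $A\#B$ is the $H$-module $A\otimes B$ with product $(a\#b)(c\#d)=\sum a(R^{(2)}\cdot c)\#(R^{(1)}\cdot b)d$.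 Then ${}_CH^*$ is $(H,R)$-Azumaya if and only if the $k$-linear map $$\theta\colon H^{*,op}\to H,\qquad\theta(f)=\sum R_C^{(1)}\langle f,R_C^{(2)}\rangle,$$ is an isomorphism (that is, bijective). -/

import Mathlib

open TensorProduct

noncomputable section

namespace HopfAzumaya

open Coalgebra LinearMap WithConv

/-! ### Quasitriangular structures -/

section RMatrix

variable {k H : Type*} [Field k] [Ring H] [HopfAlgebra k H]

/-- `R` is an R-matrix for `H`, i.e. `(H, R)` is quasitriangular: `R` is invertible in `H ⊗ H` and
`Δᵒᵖ(h) R = R Δ(h)`, `(Δ ⊗ id)(R) = R₁₃ R₂₃`, `(id ⊗ Δ)(R) = R₁₃ R₁₂`.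
In `H ⊗ (H ⊗ H)` the three legs of `R` are
`R₁₂ = ∑ R⁽¹⁾ ⊗ (R⁽²⁾ ⊗ 1)`, `R₁₃ = ∑ R⁽¹⁾ ⊗ (1 ⊗ R⁽²⁾)` and `R₂₃ = 1 ⊗ R`. -/
structure IsRMatrix (R : H ⊗[k] H) : Prop where
  isUnit : IsUnit R
  comm_comul_mul : ∀ h : H,
    TensorProduct.comm k H H (comul h) * R = R * (comul h : H ⊗[k] H)
  comul_left :
    TensorProduct.assoc k H H H (TensorProduct.map comul LinearMap.id R) =
      Algebra.TensorProduct.map (AlgHom.id k H) Algebra.TensorProduct.includeRight R *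
        (1 ⊗ₜ[k] R : H ⊗[k] (H ⊗[k] H))
  comul_right :
    TensorProduct.map LinearMap.id comul R =
      Algebra.TensorProduct.map (AlgHom.id k H) Algebra.TensorProduct.includeRight R *
        (Algebra.TensorProduct.map (AlgHom.id k H) Algebra.TensorProduct.includeLeft R :
          H ⊗[k] (H ⊗[k] H))

end RMatrix

/-! ### Azumaya algebras in the braided category of modules -/

section Azumaya

/-- `A` is an `H`-module algebra: `h • 1 = ε(h) 1` and `h • (a b) = ∑ (h₁ • a) (h₂ • b)`. -/
class IsModuleAlgebra (k H A : Type*) [Field k] [Ring H] [HopfAlgebra k H]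
    [Ring A] [Algebra k A] [Module H A] [IsScalarTower k H A] : Prop where
  smul_one : ∀ h : H, h • (1 : A) = counit (R := k) h • (1 : A)
  smul_mul : ∀ (h : H) (a b : A), h • (a * b) =
    LinearMap.mul' k A (TensorProduct.map ((toSpanSingleton H A a).restrictScalars k)
      ((toSpanSingleton H A b).restrictScalars k) (comul h))

variable {k H : Type*} [Field k] [Ring H] [HopfAlgebra k H]
variable (A : Type*) [Ring A] [Algebra k A] [Module H A] [IsScalarTower k H A]

/-- The action of `H ⊗ H` on `A ⊗ A`: `(r ⊗ s) · (a ⊗ b) = (r • a) ⊗ (s • b)`. -/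
def tensorAct : H ⊗[k] H →ₗ[k] (A ⊗[k] A →ₗ[k] A ⊗[k] A) :=
  TensorProduct.homTensorHomMap (.id k) A A A A ∘ₗ
    TensorProduct.map (Algebra.lsmul k k A : H →ₐ[k] Module.End k A).toLinearMap
      (Algebra.lsmul k k A : H →ₐ[k] Module.End k A).toLinearMap

/-- The product `a ∘ b = ∑ (R⁽²⁾ • b) (R⁽¹⁾ • a)` of the braided opposite algebra `Ā`. -/
def opMul (R : H ⊗[k] H) : A →ₗ[k] A →ₗ[k] A :=
  TensorProduct.curry
    (LinearMap.mul' k A ∘ₗ (TensorProduct.comm k A A).toLinearMap ∘ₗ tensorAct A R)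

@[simp]
theorem opMul_tmul (r s : H) (a b : A) :
    opMul A (r ⊗ₜ[k] s) a b = (s • b) * (r • a) := by
  simp [opMul, tensorAct]

/-- The canonical map `F : A # Ā → End(A)`,
`F(a # b̄)(c) = ∑ a (R⁽²⁾ • c) (R⁽¹⁾ • b)`. -/
def azumayaF (R : H ⊗[k] H) : A ⊗[k] A →ₗ[k] Module.End k A :=
  TensorProduct.lift ((LinearMap.llcomp k A A A).compl₁₂ (LinearMap.mul k A) (opMul A R))

@[simp]
theorem azumayaF_tmul (R : H ⊗[k] H) (a b c : A) :
    azumayaF A R (a ⊗ₜ[k] b) c = a * opMul A R b c := rfl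

/-- The canonical map `G : Ā # A → End(A)ᵒᵖ`, `G(ā # b)(c) = ∑ (R⁽²⁾ • a) (R⁽¹⁾ • c) b`. -/
def azumayaG (R : H ⊗[k] H) : A ⊗[k] A →ₗ[k] Module.End k A :=
  TensorProduct.lift
    ((LinearMap.llcomp k A A A).flip.compl₁₂ (opMul A R).flip (LinearMap.mul k A).flip)

@[simp]
theorem azumayaG_tmul (R : H ⊗[k] H) (a b c : A) :
    azumayaG A R (a ⊗ₜ[k] b) c = opMul A R c a * b := rfl

/-- The `H`-module algebra `A` is `(H, R)`-Azumaya: the canonical maps `A # Ā → End(A)` and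
`Ā # A → End(A)ᵒᵖ` are isomorphisms. The underlying vector spaces of `A # Ā`, `Ā # A` and
`End(A)ᵒᵖ` are `A ⊗ A`, `A ⊗ A` and `End(A)`; for an R-matrix `R` both maps are homomorphisms of
`H`-module algebras, so they are isomorphisms exactly when they are bijective. -/
structure IsBraidedAzumaya (R : H ⊗[k] H) [IsModuleAlgebra k H A] : Prop where
  bijective_F : Function.Bijective (azumayaF A R)
  bijective_G : Function.Bijective (azumayaG A R)

end Azumaya

/-! ### Two-cocycles and crossed products over the base field -/

section Cocycle

variable {k K : Type*} [Field k] [Ring K] [Bialgebra k K]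

/-- `σ : K ⊗ K → k` is a (normalised left) 2-cocycle on `K`: it is convolution invertible,
`σ(h ⊗ 1) = σ(1 ⊗ h) = ε(h)`, and
`∑ σ(l₁ ⊗ m₁) σ(h ⊗ l₂ m₂) = ∑ σ(h₁ ⊗ l₁) σ(h₂ l₂ ⊗ m)`.
Each side of the last identity is a convolution product of functionals on the coalgebra `K ⊗ K`. -/
structure IsTwoCocycle (σ : K ⊗[k] K →ₗ[k] k) : Prop where
  isUnit : IsUnit (toConv σ)
  tmul_one : ∀ h : K, σ (h ⊗ₜ 1) = counit (R := k) h
  one_tmul : ∀ h : K, σ (1 ⊗ₜ h) = counit (R := k) h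
  cocycle : ∀ h l m : K,
    (toConv σ * toConv (σ ∘ₗ TensorProduct.mk k K K h ∘ₗ LinearMap.mul' k K)) (l ⊗ₜ m) =
      (toConv σ * toConv (σ ∘ₗ (TensorProduct.mk k K K).flip m ∘ₗ LinearMap.mul' k K)) (h ⊗ₜ l)

/-- `(a ⋆ f)(d) = ∑ a(d₁) f(d₂)` for a functional `a` and a linear map `f` on a coalgebra. -/
def convSMul {D M : Type*} [AddCommGroup D] [Module k D] [Coalgebra k D]
    [AddCommGroup M] [Module k M] (a : D →ₗ[k] k) (f : D →ₗ[k] M) : D →ₗ[k] M :=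
  (TensorProduct.lid k M).toLinearMap ∘ₗ TensorProduct.map a f ∘ₗ comul

/-- The crossed product `k #_σ K = _σK`: the vector space `K` with the product
`h · l = ∑ σ(h₁ ⊗ l₁) h₂ l₂`. -/
def CrossedProduct {σ : K ⊗[k] K →ₗ[k] k} (_hσ : IsTwoCocycle σ) : Type _ := K

/-- The product `h ⊗ l ↦ ∑ σ(h₁ ⊗ l₁) h₂ l₂` of `_σK`. -/
def crossedMul (σ : K ⊗[k] K →ₗ[k] k) : K ⊗[k] K →ₗ[k] K :=
  convSMul σ (LinearMap.mul' k K)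

section
variable {D M N : Type*} [AddCommGroup D] [Module k D] [Coalgebra k D]
    [AddCommGroup M] [Module k M] [AddCommGroup N] [Module k N]

theorem convSMul_repr {ι : Type*} (a : D →ₗ[k] k) (f : D →ₗ[k] M) {d : D} (r : Repr k d ι) :
    convSMul a f d = ∑ i ∈ r.index, a (r.left i) • f (r.right i) := by
  simp [convSMul, ← r.eq]

theorem comp_convSMul (g : M →ₗ[k] N) (a : D →ₗ[k] k) (f : D →ₗ[k] M) :
    g ∘ₗ convSMul a f = convSMul a (g ∘ₗ f) := by
  ext d
  simp [convSMul_repr _ _ (ℛ k d)]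

theorem convSMul_comp_coalgHom {E : Type*} [AddCommGroup E] [Module k E] [Coalgebra k E]
    (φ : E →ₗc[k] D) (a : D →ₗ[k] k) (f : D →ₗ[k] M) :
    convSMul a f ∘ₗ φ.toLinearMap = convSMul (a ∘ₗ φ.toLinearMap) (f ∘ₗ φ.toLinearMap) := by
  rw [convSMul, convSMul, LinearMap.comp_assoc, LinearMap.comp_assoc, ← φ.map_comp_comul,
    TensorProduct.map_comp]
  simp only [LinearMap.comp_assoc]

theorem convSMul_convSMul (a b : D →ₗ[k] k) (f : D →ₗ[k] M) :
    convSMul a (convSMul b f) = convSMul (toConv a * toConv b).ofConv f := by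
  have h1 : convSMul a (convSMul b f) =
      ((TensorProduct.lid k M).toLinearMap ∘ₗ
        TensorProduct.map a ((TensorProduct.lid k M).toLinearMap ∘ₗ TensorProduct.map b f)) ∘ₗ
          comul.lTensor D ∘ₗ comul := by
    rw [LinearMap.comp_assoc, ← LinearMap.comp_assoc (f := comul) (g := lTensor D comul),
      map_comp_lTensor]
    rfl
  have h2 : convSMul (toConv a * toConv b).ofConv f =
      ((TensorProduct.lid k M).toLinearMap ∘ₗ
        TensorProduct.map (LinearMap.mul' k k ∘ₗ TensorProduct.map a b) f) ∘ₗ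
          comul.rTensor D ∘ₗ comul := by
    rw [LinearMap.comp_assoc, ← LinearMap.comp_assoc (f := comul) (g := rTensor D comul),
      map_comp_rTensor]
    rfl
  have h3 : (TensorProduct.lid k M).toLinearMap ∘ₗ
        TensorProduct.map (LinearMap.mul' k k ∘ₗ TensorProduct.map a b) f =
      ((TensorProduct.lid k M).toLinearMap ∘ₗ
        TensorProduct.map a ((TensorProduct.lid k M).toLinearMap ∘ₗ TensorProduct.map b f)) ∘ₗ
          (TensorProduct.assoc k D D D).toLinearMap := by
    ext x y z
    simp [mul_smul, smul_comm (b y)]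
  rw [h1, h2, h3, ← Coalgebra.coassoc]
  rfl

theorem convSMul_sum {ι : Type*} (t : Finset ι) (a : D →ₗ[k] k) (f : ι → D →ₗ[k] M) :
    convSMul a (∑ i ∈ t, f i) = ∑ i ∈ t, convSMul a (f i) := by
  ext d
  simp only [convSMul_repr _ _ (ℛ k d), LinearMap.sum_apply, Finset.smul_sum]
  exact Finset.sum_comm

theorem counit_convSMul (f : D →ₗ[k] M) : convSMul counit f = f := by
  ext d
  rw [convSMul_repr _ _ (ℛ k d)]
  simp only [← map_smul, ← map_sum]
  rw [Coalgebra.sum_counit_smul]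

end

theorem crossedMul_repr (σ : K ⊗[k] K →ₗ[k] k) {h l : K} {ι κ : Type*}
    (r : Repr k h ι) (s : Repr k l κ) :
    crossedMul σ (h ⊗ₜ l) = ∑ i ∈ r.index, ∑ j ∈ s.index,
      σ (r.left i ⊗ₜ s.left j) • (r.right i * s.right j) := by
  rw [crossedMul, convSMul_repr _ _ (r.tmul s)]
  simp [Repr.tmul, Finset.sum_product]

theorem crossedMul_one_tmul {σ : K ⊗[k] K →ₗ[k] k} (hσ : IsTwoCocycle σ) (h : K) :
    crossedMul σ (1 ⊗ₜ h) = h := by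
  let r : Repr k (1 : K) Unit :=
    { index := {()}, left := fun _ => 1, right := fun _ => 1, eq := by
        simp [Algebra.TensorProduct.one_def] }
  rw [crossedMul_repr σ r (ℛ k h)]
  simpa [r, hσ.one_tmul] using Coalgebra.sum_counit_smul (ℛ k h)

theorem crossedMul_tmul_one {σ : K ⊗[k] K →ₗ[k] k} (hσ : IsTwoCocycle σ) (h : K) :
    crossedMul σ (h ⊗ₜ 1) = h := by
  let r : Repr k (1 : K) Unit :=
    { index := {()}, left := fun _ => 1, right := fun _ => 1, eq := by
        simp [Algebra.TensorProduct.one_def] }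
  rw [crossedMul_repr σ (ℛ k h) r]
  simpa [r, hσ.tmul_one] using Coalgebra.sum_counit_smul (ℛ k h)

theorem crossedMul_assoc_left (σ : K ⊗[k] K →ₗ[k] k) (h l m : K) :
    crossedMul σ (crossedMul σ (h ⊗ₜ l) ⊗ₜ m) =
      ∑ i ∈ (ℛ k m).index,
        convSMul (toConv σ * toConv (σ ∘ₗ (TensorProduct.mk k K K).flip ((ℛ k m).left i) ∘ₗ
          LinearMap.mul' k K)).ofConv
          (LinearMap.mulRight k ((ℛ k m).right i) ∘ₗ LinearMap.mul' k K) (h ⊗ₜ l) := by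
  have e1 : crossedMul σ ∘ₗ (TensorProduct.mk k K K).flip m =
      ∑ i ∈ (ℛ k m).index, convSMul (σ ∘ₗ (TensorProduct.mk k K K).flip ((ℛ k m).left i))
        (LinearMap.mulRight k ((ℛ k m).right i)) := by
    ext x
    simp only [LinearMap.comp_apply, LinearMap.flip_apply, TensorProduct.mk_apply,
      LinearMap.sum_apply, convSMul_repr _ _ (ℛ k x), LinearMap.mulRight_apply,
      crossedMul_repr σ (ℛ k x) (ℛ k m)]
    exact Finset.sum_comm
  have e : (crossedMul σ ∘ₗ (TensorProduct.mk k K K).flip m) ∘ₗ LinearMap.mul' k K =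
      ∑ i ∈ (ℛ k m).index, convSMul
        (σ ∘ₗ (TensorProduct.mk k K K).flip ((ℛ k m).left i) ∘ₗ LinearMap.mul' k K)
        (LinearMap.mulRight k ((ℛ k m).right i) ∘ₗ LinearMap.mul' k K) := by
    have h2 : ∀ (a : K →ₗ[k] k) (f : K →ₗ[k] K), convSMul a f ∘ₗ LinearMap.mul' k K =
        convSMul (a ∘ₗ LinearMap.mul' k K) (f ∘ₗ LinearMap.mul' k K) := fun a f =>
      convSMul_comp_coalgHom (Bialgebra.mulCoalgHom k K) a f
    rw [e1]
    ext1
    ext x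
    simp only [← LinearMap.comp_assoc, ← h2]
    simp
  have e2 := congr($(comp_convSMul (crossedMul σ ∘ₗ (TensorProduct.mk k K K).flip m) σ
    (LinearMap.mul' k K)) (h ⊗ₜ l))
  rw [e, convSMul_sum, LinearMap.sum_apply] at e2
  simp only [← convSMul_convSMul]
  exact e2

theorem crossedMul_assoc_right (σ : K ⊗[k] K →ₗ[k] k) (h l m : K) :
    crossedMul σ (h ⊗ₜ crossedMul σ (l ⊗ₜ m)) =
      ∑ i ∈ (ℛ k h).index,
        convSMul (toConv σ * toConv (σ ∘ₗ TensorProduct.mk k K K ((ℛ k h).left i) ∘ₗ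
          LinearMap.mul' k K)).ofConv
          (LinearMap.mulLeft k ((ℛ k h).right i) ∘ₗ LinearMap.mul' k K) (l ⊗ₜ m) := by
  have e1 : crossedMul σ ∘ₗ TensorProduct.mk k K K h =
      ∑ i ∈ (ℛ k h).index, convSMul (σ ∘ₗ TensorProduct.mk k K K ((ℛ k h).left i))
        (LinearMap.mulLeft k ((ℛ k h).right i)) := by
    ext x
    simp only [LinearMap.comp_apply, TensorProduct.mk_apply,
      LinearMap.sum_apply, convSMul_repr _ _ (ℛ k x), LinearMap.mulLeft_apply,
      crossedMul_repr σ (ℛ k h) (ℛ k x)]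
  have e : (crossedMul σ ∘ₗ TensorProduct.mk k K K h) ∘ₗ LinearMap.mul' k K =
      ∑ i ∈ (ℛ k h).index, convSMul
        (σ ∘ₗ TensorProduct.mk k K K ((ℛ k h).left i) ∘ₗ LinearMap.mul' k K)
        (LinearMap.mulLeft k ((ℛ k h).right i) ∘ₗ LinearMap.mul' k K) := by
    have h2 : ∀ (a : K →ₗ[k] k) (f : K →ₗ[k] K), convSMul a f ∘ₗ LinearMap.mul' k K =
        convSMul (a ∘ₗ LinearMap.mul' k K) (f ∘ₗ LinearMap.mul' k K) := fun a f =>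
      convSMul_comp_coalgHom (Bialgebra.mulCoalgHom k K) a f
    rw [e1]
    ext1
    ext x
    simp only [← LinearMap.comp_assoc, ← h2]
    simp
  have e2 := congr($(comp_convSMul (crossedMul σ ∘ₗ TensorProduct.mk k K K h) σ
    (LinearMap.mul' k K)) (l ⊗ₜ m))
  rw [e, convSMul_sum, LinearMap.sum_apply] at e2
  simp only [← convSMul_convSMul]
  exact e2

theorem crossedMul_assoc {σ : K ⊗[k] K →ₗ[k] k} (hσ : IsTwoCocycle σ) (h l m : K) :
    crossedMul σ (crossedMul σ (h ⊗ₜ l) ⊗ₜ m) = crossedMul σ (h ⊗ₜ crossedMul σ (l ⊗ₜ m)) := by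
  have hc := hσ.cocycle
  rw [crossedMul_assoc_left, crossedMul_assoc_right]
  simp only [convSMul_repr _ _ ((ℛ k h).tmul (ℛ k l)), convSMul_repr _ _ ((ℛ k l).tmul (ℛ k m)),
    Repr.tmul_index, Repr.tmul_left, Repr.tmul_right, Finset.sum_product, LinearMap.comp_apply,
    LinearMap.mul'_apply, LinearMap.mulRight_apply, LinearMap.mulLeft_apply, hc, mul_assoc]
  rw [Finset.sum_comm]
  exact Finset.sum_congr rfl fun i _ => Finset.sum_comm

variable {σ : K ⊗[k] K →ₗ[k] k} (hσ : IsTwoCocycle σ)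

instance : Ring (CrossedProduct hσ) where
  __ := (inferInstanceAs (AddCommGroup K) : AddCommGroup (CrossedProduct hσ))
  mul a b := crossedMul σ ((a : K) ⊗ₜ (b : K))
  one := (1 : K)
  left_distrib := show ∀ a b c : K, crossedMul σ (a ⊗ₜ (b + c)) =
      crossedMul σ (a ⊗ₜ b) + crossedMul σ (a ⊗ₜ c) from fun a b c => by rw [tmul_add, map_add]
  right_distrib := show ∀ a b c : K, crossedMul σ ((a + b) ⊗ₜ c) =
      crossedMul σ (a ⊗ₜ c) + crossedMul σ (b ⊗ₜ c) from fun a b c => by rw [add_tmul, map_add]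
  zero_mul := show ∀ a : K, crossedMul σ (0 ⊗ₜ a) = 0 from fun a => by rw [zero_tmul, map_zero]
  mul_zero := show ∀ a : K, crossedMul σ (a ⊗ₜ 0) = 0 from fun a => by rw [tmul_zero, map_zero]
  mul_assoc a b c := crossedMul_assoc hσ _ _ _
  one_mul a := crossedMul_one_tmul hσ _
  mul_one a := crossedMul_tmul_one hσ _

instance : Algebra k (CrossedProduct hσ) :=
  letI : Module k (CrossedProduct hσ) := inferInstanceAs (Module k K)
  Algebra.ofModule
    (show ∀ (r : k) (a b : K), crossedMul σ ((r • a) ⊗ₜ b) = r • crossedMul σ (a ⊗ₜ b) from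
      fun r a b => by rw [← smul_tmul', map_smul])
    (show ∀ (r : k) (a b : K), crossedMul σ (a ⊗ₜ (r • b)) = r • crossedMul σ (a ⊗ₜ b) from
      fun r a b => by rw [tmul_smul, map_smul])

/-- The identity map `K → _σK`. -/
def toCrossed : K ≃ₗ[k] CrossedProduct hσ where
  toFun a := a
  invFun a := a
  map_add' _ _ := rfl
  map_smul' _ _ := rfl
  left_inv _ := rfl
  right_inv _ := rfl

theorem toCrossed_mul (a b : K) :
    toCrossed hσ a * toCrossed hσ b = toCrossed hσ (crossedMul σ (a ⊗ₜ b)) := rfl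

theorem toCrossed_one : (1 : CrossedProduct hσ) = toCrossed hσ 1 := rfl

end Cocycle

/-! ### The dual of a finite-dimensional Hopf algebra -/

section Dual

variable (k H : Type*) [Field k] [Ring H] [HopfAlgebra k H]

/-- The dual `H^*`, with the convolution product `(f g)(x) = ∑ f(x₁) g(x₂)`. -/
def HopfDual : Type _ := WithConv (H →ₗ[k] k)

instance : Ring (HopfDual k H) := inferInstanceAs (Ring (WithConv (H →ₗ[k] k)))

instance : Algebra k (HopfDual k H) := inferInstanceAs (Algebra k (WithConv (H →ₗ[k] k)))

/-- An element of `H^*` as a linear functional on `H`. -/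
def toDual : HopfDual k H ≃ₗ[k] (H →ₗ[k] k) where
  toFun f := WithConv.ofConv f
  invFun f := WithConv.toConv f
  map_add' _ _ := rfl
  map_smul' _ _ := rfl
  left_inv _ := rfl
  right_inv _ := rfl

instance : CoeFun (HopfDual k H) (fun _ => H → k) where
  coe f := toDual k H f

/-- The pairing `(H^* ⊗ H^*) → (H ⊗ H)^*`, `⟨f ⊗ g, x ⊗ y⟩ = f(x) g(y)`. -/
def dualPairing : HopfDual k H ⊗[k] HopfDual k H →ₗ[k] (H ⊗[k] H →ₗ[k] k) :=
  TensorProduct.dualDistrib k H H ∘ₗ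
    TensorProduct.map (toDual k H).toLinearMap
      (toDual k H).toLinearMap

variable {k H}

@[ext]
theorem HopfDual.ext {f g : HopfDual k H} (h : ∀ x, f x = g x) : f = g :=
  (toDual k H).injective (LinearMap.ext h)

@[simp]
theorem dual_one_apply (x : H) : (1 : HopfDual k H) x = counit (R := k) x := rfl

theorem dual_mul_repr (f g : HopfDual k H) {x : H} {ι : Type*} (r : Repr k x ι) :
    (f * g) x = ∑ i ∈ r.index, f (r.left i) * g (r.right i) :=
  r.convMul_apply (toConv (toDual k H f)) (toConv (toDual k H g))

@[simp]
theorem dualPairing_tmul (f g : HopfDual k H) (x y : H) :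
    dualPairing k H (f ⊗ₜ g) (x ⊗ₜ y) = f x * g y := by
  simp [dualPairing]

/-- An element of `H ⊗ H` viewed as a functional on `H^* ⊗ H^*`:
`⟨C, f ⊗ g⟩ = ∑ f(C⁽¹⁾) g(C⁽²⁾)`. -/
def evalTensor (C : H ⊗[k] H) : HopfDual k H ⊗[k] HopfDual k H →ₗ[k] k :=
  (dualPairing k H).flip C

@[simp]
theorem evalTensor_tmul (x y : H) (f g : HopfDual k H) :
    evalTensor (x ⊗ₜ[k] y) (f ⊗ₜ g) = f x * g y := by
  simp [evalTensor]

theorem dualPairing_mul_repr (s t : HopfDual k H ⊗[k] HopfDual k H) {x y : H} {ι κ : Type*}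
    (r : Repr k x ι) (r' : Repr k y κ) :
    dualPairing k H (s * t) (x ⊗ₜ y) = ∑ i ∈ r.index, ∑ j ∈ r'.index,
      dualPairing k H s (r.left i ⊗ₜ r'.left j) * dualPairing k H t (r.right i ⊗ₜ r'.right j) := by
  induction s with
  | zero => simp
  | add s s' hs hs' =>
    simp only [map_add, add_mul, LinearMap.add_apply, hs, hs', Finset.sum_add_distrib]
  | tmul f g =>
    induction t with
    | zero => simp
    | add t t' ht ht' =>
      simp only [map_add, mul_add, LinearMap.add_apply, ht, ht', Finset.sum_add_distrib]
    | tmul f' g' =>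
      rw [Algebra.TensorProduct.tmul_mul_tmul, dualPairing_tmul, dual_mul_repr _ _ r,
        dual_mul_repr _ _ r', Finset.sum_mul_sum]
      simp only [dualPairing_tmul]
      refine Finset.sum_congr rfl fun i _ => Finset.sum_congr rfl fun j _ => by ring

/-- The pairing of `H^* ⊗ (H^* ⊗ H^*)` with `H ⊗ (H ⊗ H)`. -/
def dualPairing₃ : HopfDual k H ⊗[k] (HopfDual k H ⊗[k] HopfDual k H) →ₗ[k]
    (H ⊗[k] (H ⊗[k] H) →ₗ[k] k) :=
  TensorProduct.dualDistrib k H (H ⊗[k] H) ∘ₗ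
    TensorProduct.map (toDual k H).toLinearMap (dualPairing k H)

theorem dualPairing₃_tmul (f : HopfDual k H) (t : HopfDual k H ⊗[k] HopfDual k H)
    (x : H) (w : H ⊗[k] H) :
    dualPairing₃ (f ⊗ₜ t) (x ⊗ₜ w) = f x * dualPairing k H t w := by
  simp [dualPairing₃]

theorem dualPairing₃_assoc (s : HopfDual k H ⊗[k] HopfDual k H) (g : HopfDual k H) (x y z : H) :
    dualPairing₃ (TensorProduct.assoc k _ _ _ (s ⊗ₜ g)) (x ⊗ₜ (y ⊗ₜ z)) =
      dualPairing k H s (x ⊗ₜ y) * g z := by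
  induction s with
  | zero => simp
  | add s t hs ht => simp only [map_add, LinearMap.add_apply, hs, ht, add_tmul, add_mul]
  | tmul f g => simp [dualPairing₃_tmul, mul_assoc]

variable [Module.Finite k H]

theorem dualPairing_bijective : Function.Bijective (dualPairing k H) := by
  have h1 : Function.Bijective (TensorProduct.dualDistrib k H H) :=
    (TensorProduct.dualDistribEquiv k H H).bijective
  have h2 := (TensorProduct.congr (toDual k H)
    (toDual k H)).bijective
  exact h1.comp h2

/-- The pairing `H^* ⊗ H^* ≃ (H ⊗ H)^*` for a finite-dimensional `H`. -/
def dualPairingEquiv : HopfDual k H ⊗[k] HopfDual k H ≃ₗ[k] (H ⊗[k] H →ₗ[k] k) :=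
  LinearEquiv.ofBijective (dualPairing k H) dualPairing_bijective

/-- The coproduct `Δ(f) = ∑ f₁ ⊗ f₂` of `H^*` is determined by `f(x y) = ∑ f₁(x) f₂(y)`,
and its counit is `f ↦ f(1)`. -/
instance : CoalgebraStruct k (HopfDual k H) where
  comul := dualPairingEquiv.symm.toLinearMap ∘ₗ
    (LinearMap.lcomp k k (LinearMap.mul' k H)) ∘ₗ (toDual k H).toLinearMap
  counit := LinearMap.applyₗ (1 : H) ∘ₗ (toDual k H).toLinearMap

theorem dualPairing_comul (f : HopfDual k H) (x y : H) :
    dualPairing k H (comul f) (x ⊗ₜ y) = f (x * y) := by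
  have : dualPairing k H (comul f) = toDual k H f ∘ₗ LinearMap.mul' k H :=
    dualPairingEquiv.apply_symm_apply _
  simp [this]

@[simp]
theorem dual_counit_apply (f : HopfDual k H) : counit (R := k) f = f 1 := rfl

theorem dualPairing_ext {s t : HopfDual k H ⊗[k] HopfDual k H}
    (h : ∀ x y, dualPairing k H s (x ⊗ₜ y) = dualPairing k H t (x ⊗ₜ y)) : s = t := by
  apply dualPairing_bijective.1
  ext x y
  exact h x y

theorem dualPairing₃_injective : Function.Injective (dualPairing₃ (k := k) (H := H)) := by
  have h1 : Function.Bijective (TensorProduct.dualDistrib k H (H ⊗[k] H)) :=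
    (TensorProduct.dualDistribEquiv k H (H ⊗[k] H)).bijective
  have h2 := (TensorProduct.congr (toDual k H)
    (dualPairingEquiv (k := k) (H := H))).bijective
  exact (h1.comp h2).1

theorem dualPairing₃_lTensor (t : HopfDual k H ⊗[k] HopfDual k H) (x y z : H) :
    dualPairing₃ (comul.lTensor _ t) (x ⊗ₜ (y ⊗ₜ z)) = dualPairing k H t (x ⊗ₜ (y * z)) := by
  induction t with
  | zero => simp
  | add s t hs ht => simp only [map_add, LinearMap.add_apply, hs, ht]
  | tmul f g => simp [dualPairing₃_tmul, dualPairing_comul]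

theorem dualPairing₃_rTensor (t : HopfDual k H ⊗[k] HopfDual k H) (x y z : H) :
    dualPairing₃ (TensorProduct.assoc k _ _ _ (comul.rTensor _ t)) (x ⊗ₜ (y ⊗ₜ z)) =
      dualPairing k H t ((x * y) ⊗ₜ z) := by
  induction t with
  | zero => simp
  | add s t hs ht => simp only [map_add, LinearMap.add_apply, hs, ht]
  | tmul f g => simp [dualPairing₃_assoc, dualPairing_comul]

theorem lid_rTensor_counit (t : HopfDual k H ⊗[k] HopfDual k H) (x : H) :
    (TensorProduct.lid k (HopfDual k H) (counit.rTensor _ t)) x =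
      dualPairing k H t (1 ⊗ₜ x) := by
  induction t with
  | zero => simp
  | add s t hs ht => simp only [map_add, LinearMap.add_apply, hs, ht]
  | tmul f g => simp

theorem rid_lTensor_counit (t : HopfDual k H ⊗[k] HopfDual k H) (x : H) :
    (TensorProduct.rid k (HopfDual k H) (counit.lTensor _ t)) x =
      dualPairing k H t (x ⊗ₜ 1) := by
  induction t with
  | zero => simp
  | add s t hs ht => simp only [map_add, LinearMap.add_apply, hs, ht]
  | tmul f g => simp [mul_comm]

instance : Coalgebra k (HopfDual k H) where
  coassoc := by
    ext1 f
    apply dualPairing₃_injective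
    ext x y z
    simp [dualPairing₃_lTensor, dualPairing₃_rTensor, dualPairing_comul, mul_assoc]
  rTensor_counit_comp_comul := by
    ext f
    apply (TensorProduct.lid k (HopfDual k H)).injective
    ext x
    simp [lid_rTensor_counit, dualPairing_comul]
  lTensor_counit_comp_comul := by
    ext f
    apply (TensorProduct.rid k (HopfDual k H)).injective
    ext x
    simp [rid_lTensor_counit, dualPairing_comul]

/-- The dual of a finite-dimensional Hopf algebra is a bialgebra. -/
instance : Bialgebra k (HopfDual k H) :=
  Bialgebra.mk' k (HopfDual k H)
    (by simp)
    (by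
      intro f g
      let r : Repr k (1 : H) Unit :=
        { index := {()}, left := fun _ => 1, right := fun _ => 1, eq := by
            simp [Algebra.TensorProduct.one_def] }
      rw [dual_counit_apply, dual_mul_repr f g r]
      simp [r])
    (by
      apply dualPairing_ext
      intro x y
      rw [dualPairing_comul]
      simp [Algebra.TensorProduct.one_def])
    (by
      intro f g
      apply dualPairing_ext
      intro x y
      rw [dualPairing_comul, dualPairing_mul_repr _ _ (ℛ k x) (ℛ k y),
        dual_mul_repr f g ((ℛ k x).mul (ℛ k y))]
      simp [Finset.sum_product, dualPairing_comul])

/-- The left `H`-action `h ⇀ f = ∑ f₁ ⟨f₂, h⟩` on `H^*`. -/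
def dualAct (h : H) : HopfDual k H →ₗ[k] HopfDual k H :=
  (TensorProduct.rid k (HopfDual k H)).toLinearMap ∘ₗ
    (LinearMap.applyₗ h ∘ₗ (toDual k H).toLinearMap).lTensor (HopfDual k H) ∘ₗ comul

theorem dualAct_apply (h : H) (f : HopfDual k H) (x : H) : dualAct h f x = f (x * h) := by
  have : ∀ t : HopfDual k H ⊗[k] HopfDual k H,
      (TensorProduct.rid k (HopfDual k H) ((LinearMap.applyₗ h ∘ₗ
        (toDual k H).toLinearMap).lTensor (HopfDual k H) t)) x = dualPairing k H t (x ⊗ₜ h) := by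
    intro t
    induction t with
    | zero => simp
    | add s t hs ht => simp only [map_add, LinearMap.add_apply, hs, ht]
    | tmul f g => simp [mul_comm]
  rw [← dualPairing_comul, ← this]
  rfl

theorem comul_dualAct (h : H) (f : HopfDual k H) :
    comul (dualAct h f) = (dualAct h).lTensor (HopfDual k H) (comul f) := by
  have : ∀ (t : HopfDual k H ⊗[k] HopfDual k H) (x y : H),
      dualPairing k H ((dualAct h).lTensor (HopfDual k H) t) (x ⊗ₜ y) =
        dualPairing k H t (x ⊗ₜ (y * h)) := by
    intro t x y
    induction t with
    | zero => simp
    | add s t hs ht => simp only [map_add, LinearMap.add_apply, hs, ht]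
    | tmul f g => simp [dualAct_apply]
  apply dualPairing_ext
  intro x y
  rw [this, dualPairing_comul, dualPairing_comul, dualAct_apply, mul_assoc]

theorem dualAct_mul (h : H) (f g : HopfDual k H) {ι : Type*} (r : Repr k h ι) :
    dualAct h (f * g) = ∑ i ∈ r.index, dualAct (r.left i) f * dualAct (r.right i) g := by
  ext x
  rw [dualAct_apply, dual_mul_repr f g ((ℛ k x).mul r)]
  simp only [map_sum, LinearMap.sum_apply, dual_mul_repr _ _ (ℛ k x), dualAct_apply]
  simp [Finset.sum_product]
  exact Finset.sum_comm

variable {σ : HopfDual k H ⊗[k] HopfDual k H →ₗ[k] k} (hσ : IsTwoCocycle σ)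

/-- The `H`-action `h ⇀ f = ∑ f₁ ⟨f₂, h⟩` on the crossed product `_σ H^*`. -/
instance : Module H (CrossedProduct hσ) where
  smul h a := toCrossed hσ (dualAct h ((toCrossed hσ).symm a))
  one_smul a := (toCrossed hσ).symm.injective (HopfDual.ext fun x => by
    change dualAct (1 : H) ((toCrossed hσ).symm a) x = _
    rw [dualAct_apply, mul_one])
  mul_smul h h' a := (toCrossed hσ).symm.injective (HopfDual.ext fun x => by
    change dualAct (h * h') ((toCrossed hσ).symm a) x =
      dualAct h (dualAct h' ((toCrossed hσ).symm a)) x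
    simp only [dualAct_apply, mul_assoc])
  smul_zero h := by
    change toCrossed hσ (dualAct h ((toCrossed hσ).symm 0)) = 0
    simp only [map_zero]
  smul_add h a b := by
    change toCrossed hσ (dualAct h ((toCrossed hσ).symm (a + b))) = _
    simp only [map_add]
    rfl
  add_smul h h' a := (toCrossed hσ).symm.injective (HopfDual.ext fun x => by
    change dualAct (h + h') ((toCrossed hσ).symm a) x =
      (dualAct h ((toCrossed hσ).symm a) + dualAct h' ((toCrossed hσ).symm a)) x
    simp only [dualAct_apply, map_add, LinearMap.add_apply, mul_add])
  zero_smul a := (toCrossed hσ).symm.injective (HopfDual.ext fun x => by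
    change dualAct (0 : H) ((toCrossed hσ).symm a) x = _
    simp [dualAct_apply])

theorem smul_toCrossed (h : H) (f : HopfDual k H) :
    h • toCrossed hσ f = toCrossed hσ (dualAct h f) := rfl

instance : IsScalarTower k H (CrossedProduct hσ) where
  smul_assoc c h a := (toCrossed hσ).symm.injective (HopfDual.ext fun x => by
    change dualAct (c • h) ((toCrossed hσ).symm a) x =
      (c • dualAct h ((toCrossed hσ).symm a)) x
    simp [dualAct_apply])

instance : IsModuleAlgebra k H (CrossedProduct hσ) where
  smul_one h := (toCrossed hσ).symm.injective (HopfDual.ext fun x => by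
    change dualAct h (1 : HopfDual k H) x = (counit (R := k) h • (1 : HopfDual k H)) x
    rw [dualAct_apply]
    simp [mul_comm])
  smul_mul h a b := by
    obtain ⟨a, rfl⟩ := (toCrossed hσ).surjective a
    obtain ⟨b, rfl⟩ := (toCrossed hσ).surjective b
    have key : ∀ u v : H, crossedMul σ (dualAct u a ⊗ₜ dualAct v b) =
        ∑ i ∈ (ℛ k a).index, ∑ j ∈ (ℛ k b).index, σ ((ℛ k a).left i ⊗ₜ (ℛ k b).left j) •
          (dualAct u ((ℛ k a).right i) * dualAct v ((ℛ k b).right j)) := by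
      intro u v
      let r : ∀ (u : H) (f : HopfDual k H), Repr k (dualAct u f) _ := fun u f =>
        { index := (ℛ k f).index
          left := (ℛ k f).left
          right := fun i => dualAct u ((ℛ k f).right i)
          eq := by
            rw [comul_dualAct, ← (ℛ k f).eq]
            simp }
      exact crossedMul_repr σ (r u a) (r v b)
    rw [← (ℛ k h).eq]
    simp only [map_sum, TensorProduct.map_tmul, LinearMap.mul'_apply,
      LinearMap.restrictScalars_apply, LinearMap.toSpanSingleton_apply, smul_toCrossed,
      toCrossed_mul, key, crossedMul_repr σ (ℛ k a) (ℛ k b), map_smul,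
      Finset.smul_sum, smul_comm h, dualAct_mul h _ _ (ℛ k h)]
    exact (Finset.sum_congr rfl fun i _ => Finset.sum_comm).trans Finset.sum_comm

end Dual

/-! ### The twisted R-matrix and the map `θ` -/

section Twist

variable {k H : Type*} [Field k] [Ring H] [HopfAlgebra k H]

/-- `R_C = (τ C) R C⁻¹`. -/
def twistedR (R : H ⊗[k] H) (C : (H ⊗[k] H)ˣ) : H ⊗[k] H :=
  TensorProduct.comm k H H (C : H ⊗[k] H) * R * ((C⁻¹ : (H ⊗[k] H)ˣ) : H ⊗[k] H)

/-- The linear map `H^* → H`, `f ↦ ∑ Q⁽¹⁾ ⟨f, Q⁽²⁾⟩`, defined by `Q ∈ H ⊗ H`. -/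
def theta (Q : H ⊗[k] H) : HopfDual k H →ₗ[k] H :=
  (TensorProduct.rid k H).toLinearMap ∘ₗ
    (LinearMap.lTensorHom H ∘ₗ (toDual k H).toLinearMap).flip Q

@[simp]
theorem theta_tmul (x y : H) (f : HopfDual k H) : theta (x ⊗ₜ[k] y) f = f y • x := by
  simp [theta]

end Twist


end HopfAzumaya
end

open HopfAzumaya

open TensorProduct

noncomputable section

/-! Write `A` for the crossed product, `γ` for the identity map `H^* → A` and `R_C` for the twisted
R-matrix. Dually, the product of `A` reads `(f·g)(x) = ⟨f ⊗ g, C Δ(x)⟩`, and since `τ(C Δ(x)) R =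
τ(C) R Δ(x) = R_C C Δ(x)`, the braided opposite product is `(f ∘ g)(x) = ⟨f ⊗ g, R_C C Δ(x)⟩`.
Moving `R_C` onto the functionals turns `f ∘ g` into `∑ f₂ · g(θ'(f₁) -)`, or equally `∑ f(θ(g₁) -)
· g₂`, where `θ` is given by `R_C` and `θ'` by `τ(R_C)` (`opMul_toCrossed_eq_sum_left`,
`opMul_toCrossed_eq_sum_right`).

Hence, up to evident linear isomorphisms, `F` is a composite of three maps: the Galois map `b ⊗ a ↦
∑ b₁ ⊗ a b₂`, then `θ' ⊗ id`, then `h ⊗ a ↦ (c ↦ a · c(h -))`. The map `G` factors in the same way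
through `θ ⊗ id`. The outer maps are bijective as soon as `γ` is convolution invertible, with values
both in `A` and in `Aᵒᵖ` (`galoisMap_bijective`, `convEval_bijective`). Over a field the factor `A ≠
0` can be cancelled, so `F` is bijective iff `θ'` is, and `G` iff `θ` is. As `θ'` is the transpose
of `θ`, the two conditions agree.

Invertibility of `γ` into `A` comes from the antipode `S`; into `Aᵒᵖ` it needs the inverse of `S`,
which exists because the Drinfeld element `u` satisfies `S²(x) u = u x` and is left invertible. -/

namespace HopfAzumaya

open Coalgebra LinearMap WithConv

/-! ### The Drinfeld element and bijectivity of the antipode -/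

section Antipode

open HopfAlgebra

variable {k H : Type*} [Field k] [Ring H] [HopfAlgebra k H]

/-- The linear map `x ⊗ y ↦ s(y) w x`. -/
def sandwich (s : H →ₗ[k] H) (w : H) : H ⊗[k] H →ₗ[k] H :=
  LinearMap.mul' k H ∘ₗ (TensorProduct.comm k H H).toLinearMap ∘ₗ
    TensorProduct.map (LinearMap.mulLeft k w) s

@[simp]
theorem sandwich_tmul (s : H →ₗ[k] H) (w x y : H) :
    sandwich s w (x ⊗ₜ[k] y) = s y * (w * x) := by
  simp [sandwich]

theorem sandwich_smul (s : H →ₗ[k] H) (c : k) (w : H) (t : H ⊗[k] H) :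
    sandwich s (c • w) t = c • sandwich s w t := by
  induction t with
  | zero => simp
  | add t t' ht ht' => simp only [map_add, ht, ht', smul_add]
  | tmul x y => simp

/-- For anti-multiplicative `s`, `w · (x ⊗ y) = s(y) w x` is a right action of `H ⊗ H` on `H`. The
Drinfeld element is then `1 · R`, and its properties follow by acting on `1`. -/
theorem sandwich_mul {s : H →ₗ[k] H} (hs : ∀ x y, s (x * y) = s y * s x) (w : H)
    (t t' : H ⊗[k] H) : sandwich s w (t * t') = sandwich s (sandwich s w t) t' := by
  induction t' with
  | zero => simp
  | add a b ha hb => simp only [mul_add, map_add, ha, hb]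
  | tmul x y =>
    induction t with
    | zero => simp
    | add a b ha hb => simp only [sandwich_tmul, add_mul, map_add, mul_add] at *; rw [ha, hb]
    | tmul x' y' => simp [hs, mul_assoc]

theorem sandwich_antipode_comm_comul (x : H) :
    sandwich (antipode k) 1 (TensorProduct.comm k H H (comul x)) =
      counit (R := k) x • (1 : H) := by
  rw [← sum_antipode_mul_eq_smul (ℛ k x), ← (ℛ k x).eq]
  simp

/-- The Drinfeld element `∑ S(R⁽²⁾) R⁽¹⁾`. -/
def drinfeldElement (R : H ⊗[k] H) : H := sandwich (antipode k) 1 R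

/-- `u · Δ(x) = 1 · (R Δ(x)) = (1 · τΔ(x)) · R`, and `1 · τΔ(x) = ∑ S(x₁) x₂ = ε(x)`. -/
theorem sandwich_drinfeldElement_comul {R : H ⊗[k] H} (hR : IsRMatrix R) (x : H) :
    sandwich (antipode k) (drinfeldElement R) (comul x) =
      counit (R := k) x • drinfeldElement R := by
  rw [drinfeldElement, ← sandwich_mul antipode_mul_antidistrib, ← hR.comm_comul_mul,
    sandwich_mul antipode_mul_antidistrib, sandwich_antipode_comm_comul, sandwich_smul]

/-- The element `∑ S²(x₃) S(x₂) u x₁` is computed in two ways. Grouping `x₁, x₂` gives `S²(x) u` by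
the previous lemma; grouping `x₂, x₃` as `S(x₂ S(x₃))` gives `u x`. -/
theorem antipode_antipode_mul_drinfeldElement {R : H ⊗[k] H} (hR : IsRMatrix R) (x : H) :
    antipode k (antipode k x) * drinfeldElement R = drinfeldElement R * x := by
  let L : H ⊗[k] (H ⊗[k] H) →ₗ[k] H := sandwich (antipode k) (drinfeldElement R) ∘ₗ
    (LinearMap.mul' k H ∘ₗ (antipode k).lTensor H).lTensor H
  have hL : ∀ (t : H ⊗[k] H) (c : H), L (TensorProduct.assoc k H H H (t ⊗ₜ c)) =
      antipode k (antipode k c) * sandwich (antipode k) (drinfeldElement R) t := by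
    intro t c
    induction t with
    | zero => simp
    | add a b ha hb => simp only [add_tmul, map_add, mul_add, ha, hb]
    | tmul a b => simp [L, antipode_mul_antidistrib, mul_assoc]
  have h := congr(L $(coassoc_apply (R := k) x))
  rw [← (ℛ k x).eq] at h
  simp only [map_sum, rTensor_tmul, lTensor_tmul, hL, sandwich_drinfeldElement_comul hR] at h
  have e : ∀ a b : H, L (a ⊗ₜ comul b) = drinfeldElement R * (counit (R := k) b • a) := by
    intro a b
    simp only [L, LinearMap.comp_apply, lTensor_tmul]
    rw [mul_antipode_lTensor_comul_apply]
    simp [Algebra.algebraMap_eq_smul_one]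
  simp only [e] at h
  rw [← Finset.mul_sum] at h
  have h1 : ∑ i ∈ (ℛ k x).index, counit (R := k) ((ℛ k x).right i) • (ℛ k x).left i = x := by
    have := congr(TensorProduct.rid k H $(sum_tmul_counit_eq (ℛ k x)))
    simpa only [map_sum, TensorProduct.rid_tmul, one_smul] using this
  rw [h1] at h
  rw [← h]
  conv_lhs => rw [← sum_counit_smul (ℛ k x)]
  simp [Finset.sum_mul]

/-- Acting on `u = 1 · R` by `R⁻¹` gives back `1`, while `u · (a ⊗ b) = S(b) u a = S(b) S²(a) u`
always lies in `H u`. -/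
theorem exists_mul_drinfeldElement_eq_one {R : H ⊗[k] H} (hR : IsRMatrix R) :
    ∃ z, z * drinfeldElement R = 1 := by
  have key : ∀ t : H ⊗[k] H, ∃ z,
      sandwich (antipode k) (drinfeldElement R) t = z * drinfeldElement R := by
    intro t
    induction t with
    | zero => exact ⟨0, by simp⟩
    | add a b ha hb =>
      obtain ⟨z, hz⟩ := ha
      obtain ⟨z', hz'⟩ := hb
      exact ⟨z + z', by rw [map_add, hz, hz', add_mul]⟩
    | tmul a b =>
      exact ⟨antipode k b * antipode k (antipode k a), by
        rw [sandwich_tmul, mul_assoc, antipode_antipode_mul_drinfeldElement hR]⟩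
  obtain ⟨D, hD, -⟩ := isUnit_iff_exists.1 hR.isUnit
  obtain ⟨z, hz⟩ := key D
  refine ⟨z, ?_⟩
  rw [← hz, drinfeldElement, ← sandwich_mul antipode_mul_antidistrib, hD]
  simp [Algebra.TensorProduct.one_def]

theorem antipode_injective {R : H ⊗[k] H} (hR : IsRMatrix R) :
    Function.Injective (antipode k : H →ₗ[k] H) := by
  rw [injective_iff_map_eq_zero]
  intro x hx
  obtain ⟨z, hz⟩ := exists_mul_drinfeldElement_eq_one hR
  rw [← one_mul x, ← hz, mul_assoc, ← antipode_antipode_mul_drinfeldElement hR, hx]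
  simp

/-- A quasitriangular finite-dimensional Hopf algebra has a skew antipode. -/
theorem exists_skew_antipode [Module.Finite k H] {R : H ⊗[k] H} (hR : IsRMatrix R) :
    ∃ T : H →ₗ[k] H, (∀ x y, T (x * y) = T y * T x) ∧
      ∀ x, sandwich T 1 (comul x) = counit (R := k) x • (1 : H) := by
  let e := LinearEquiv.ofInjectiveEndo _ (antipode_injective hR)
  have he : ∀ x, e x = antipode k x := fun x => rfl
  -- The skew antipode is `S⁻¹`; applying the injective `S` reduces both identities to those of the
  -- antipode.
  refine ⟨e.symm.toLinearMap, fun x y => e.injective ?_, fun x => e.injective ?_⟩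
  · simp only [LinearEquiv.coe_coe, LinearEquiv.apply_symm_apply]
    rw [he, antipode_mul_antidistrib, ← he, ← he]
    simp
  · rw [map_smul, he 1, antipode_one, ← sum_antipode_mul_eq_smul (ℛ k x), ← (ℛ k x).eq]
    simp only [map_sum]
    refine Finset.sum_congr rfl fun i _ => ?_
    rw [sandwich_tmul, he, antipode_mul_antidistrib, ← he (_ : H)]
    simp [← he]

end Antipode

/-! ### Galois maps and convolution inverses -/

section Convolution

variable {k K A : Type*} [Field k] [AddCommGroup K] [Module k K] [Coalgebra k K]
  [Ring A] [Algebra k A]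

/-- The Galois map `a ⊗ b ↦ a₁ ⊗ ι(a₂) b`. -/
def galoisMap (i : K →ₗ[k] A) : K ⊗[k] A →ₗ[k] K ⊗[k] A :=
  (LinearMap.mul' k A ∘ₗ i.rTensor A).lTensor K ∘ₗ
    (TensorProduct.assoc k K K A).toLinearMap ∘ₗ comul.rTensor A

theorem galoisMap_repr (i : K →ₗ[k] A) {a : K} {ι : Type*} (r : Repr k a ι) (b : A) :
    galoisMap i (a ⊗ₜ b) = ∑ j ∈ r.index, r.left j ⊗ₜ (i (r.right j) * b) := by
  simp [galoisMap, ← r.eq, sum_tmul]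

theorem galoisMap_comp (i j : K →ₗ[k] A) :
    galoisMap i ∘ₗ galoisMap j = galoisMap (toConv i * toConv j).ofConv := by
  ext a b
  let L : K ⊗[k] (K ⊗[k] K) →ₗ[k] K ⊗[k] A :=
    (LinearMap.mulRight k b ∘ₗ LinearMap.mul' k A ∘ₗ TensorProduct.map i j).lTensor K
  have h := congr(L $(coassoc_apply (R := k) a))
  rw [← (ℛ k a).eq] at h
  simp only [map_sum, rTensor_tmul, lTensor_tmul] at h
  simp only [AlgebraTensorModule.curry_apply, curry_apply, restrictScalars_self, comp_apply,
    galoisMap_repr _ (ℛ k a), map_sum]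
  refine Eq.trans (Finset.sum_congr rfl fun x _ => ?_) h
  rw [galoisMap_repr _ (ℛ k _), ← (ℛ k ((ℛ k a).left x)).eq]
  simp [L, sum_tmul, mul_assoc]

theorem galoisMap_one : galoisMap (1 : WithConv (K →ₗ[k] A)).ofConv = LinearMap.id := by
  ext a b
  have h := congr((LinearMap.toSpanSingleton k A b).lTensor K $(sum_tmul_counit_eq (ℛ k a)))
  simp only [map_sum, lTensor_tmul, toSpanSingleton_apply, one_smul] at h
  simpa [galoisMap_repr _ (ℛ k a), LinearMap.convOne_def, Algebra.algebraMap_eq_smul_one] using h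

/-- `galoisMap` takes convolution to composition and the convolution unit to the identity, so a
convolution inverse of `i` supplies the inverse map. -/
theorem galoisMap_bijective {i : K →ₗ[k] A} (hi : IsUnit (toConv i)) :
    Function.Bijective (galoisMap i) := by
  obtain ⟨j, h1, h2⟩ := isUnit_iff_exists.1 hi
  refine Function.bijective_iff_has_inverse.2 ⟨galoisMap j.ofConv, fun x => ?_, fun x => ?_⟩
  · rw [← LinearMap.comp_apply, galoisMap_comp, toConv_ofConv, h2, galoisMap_one, id_apply]
  · rw [← LinearMap.comp_apply, galoisMap_comp, toConv_ofConv, h1, galoisMap_one, id_apply]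

/-- The convolution algebra is finite-dimensional, hence Artinian, so a one-sided inverse is
two-sided. Only one of the two identities for an inverse of `γ` then has to be computed. -/
theorem isUnit_of_convMul_eq_one [Module.Finite k K] [Module.Finite k A]
    {f g : WithConv (K →ₗ[k] A)} (h : f * g = 1) : IsUnit g := by
  have : Module.Finite k (WithConv (K →ₗ[k] A)) :=
    Module.Finite.equiv (WithConv.linearEquiv k (K →ₗ[k] A)).symm
  have : IsArtinianRing (WithConv (K →ₗ[k] A)) := IsArtinianRing.of_finite k _
  exact IsUnit.of_mul_eq_one_right f h

end Convolution

/-! ### Evaluation on `H^*` and the product of the crossed product -/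

section Evaluation

variable {k H : Type*} [Field k] [Ring H] [HopfAlgebra k H]

/-- The functional `x ↦ f(h x)`. -/
def leftTranslate (h : H) : HopfDual k H →ₗ[k] HopfDual k H :=
  (toDual k H).symm.toLinearMap ∘ₗ LinearMap.lcomp k k (LinearMap.mulLeft k h) ∘ₗ
    (toDual k H).toLinearMap

@[simp]
theorem leftTranslate_apply (h x : H) (f : HopfDual k H) : leftTranslate h f x = f (h * x) := rfl

variable [Module.Finite k H]

instance : Module.Finite k (HopfDual k H) := Module.Finite.equiv (toDual k H).symm

theorem sum_left_smul_right (h : H) {f : HopfDual k H} {ι : Type*} (r : Repr k f ι) :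
    ∑ i ∈ r.index, r.left i h • r.right i = leftTranslate h f := by
  ext x
  rw [leftTranslate_apply, ← dualPairing_comul, ← r.eq]
  simp

variable (k H) in
/-- The isomorphism `H ⊗ A ≃ Hom(H^*, A)`, `h ⊗ a ↦ (f ↦ f(h) a)`. -/
def evalHomEquiv (A : Type*) [AddCommGroup A] [Module k A] :
    H ⊗[k] A ≃ₗ[k] (HopfDual k H →ₗ[k] A) :=
  TensorProduct.congr (Module.evalEquiv k H ≪≫ₗ (toDual k H).dualMap) (.refl k A) ≪≫ₗ
    dualTensorHomEquiv k (HopfDual k H) A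

@[simp]
theorem evalHomEquiv_tmul {A : Type*} [AddCommGroup A] [Module k A] (h : H) (a : A)
    (f : HopfDual k H) : evalHomEquiv k H A (h ⊗ₜ a) f = f h • a := by
  simp [evalHomEquiv, dualTensorHomEquiv]

/-- The map `H ⊗ A → Hom(H^*, A)`, `h ⊗ a ↦ (f ↦ a ι(f(h ·)))`. -/
def convEval {A : Type*} [Ring A] [Algebra k A] (i : HopfDual k H →ₗ[k] A) :
    H ⊗[k] A →ₗ[k] (HopfDual k H →ₗ[k] A) :=
  (WithConv.linearEquiv k _).toLinearMap ∘ₗ LinearMap.mulRight k (toConv i) ∘ₗ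
    (WithConv.linearEquiv k _).symm.toLinearMap ∘ₗ (evalHomEquiv k H A).toLinearMap

theorem convEval_tmul {A : Type*} [Ring A] [Algebra k A] (i : HopfDual k H →ₗ[k] A) (h : H)
    (a : A) (f : HopfDual k H) : convEval i (h ⊗ₜ a) f = a * i (leftTranslate h f) := by
  have : convEval i (h ⊗ₜ a) f = (toConv (evalHomEquiv k H A (h ⊗ₜ a)) * toConv i) f := rfl
  rw [this, (ℛ k f).convMul_apply, ← sum_left_smul_right h (ℛ k f)]
  simp [Finset.mul_sum]

/-- Under `H ⊗ A ≃ Hom(H^*, A)` this map is right convolution by `i`, which is bijective when `i` is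
a unit. -/
theorem convEval_bijective {A : Type*} [Ring A] [Algebra k A] {i : HopfDual k H →ₗ[k] A}
    (hi : IsUnit (toConv i)) : Function.Bijective (convEval i) :=
  (WithConv.linearEquiv k _).bijective.comp ((IsUnit.isUnit_iff_mulRight_bijective.1 hi).comp
    ((WithConv.linearEquiv k _).symm.bijective.comp (evalHomEquiv k H A).bijective))

/-- This transfers products of functionals to products in `H ⊗ H`, where the cocycle and the
R-matrix can be manipulated directly. -/
theorem crossedMul_evalTensor_apply (W : H ⊗[k] H) (f g : HopfDual k H) (x : H) :
    crossedMul (evalTensor W) (f ⊗ₜ g) x = dualPairing k H (f ⊗ₜ g) (W * comul x) := by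
  rw [crossedMul_repr _ (ℛ k f) (ℛ k g)]
  simp only [map_sum, LinearMap.sum_apply, map_smul, LinearMap.smul_apply,
    dual_mul_repr _ _ (ℛ k x)]
  rw [← (ℛ k x).eq]
  induction W with
  | zero => simp [evalTensor]
  | add s t hs ht =>
    simp only [add_mul, map_add, ← hs, ← ht, evalTensor, LinearMap.add_apply, add_smul,
      Finset.sum_add_distrib]
  | tmul p q =>
    simp only [Finset.mul_sum, Algebra.TensorProduct.tmul_mul_tmul, map_sum, dualPairing_tmul,
      ← dualPairing_comul]
    conv_rhs => rw [← (ℛ k f).eq, ← (ℛ k g).eq]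
    simp only [map_sum, LinearMap.sum_apply, dualPairing_tmul, evalTensor_tmul, smul_eq_mul,
      Finset.mul_sum, Finset.sum_mul]
    refine (Finset.sum_congr rfl fun _ _ => Finset.sum_comm).trans (Finset.sum_comm.trans ?_)
    refine Finset.sum_congr rfl fun _ _ => Finset.sum_comm.trans ?_
    exact Finset.sum_congr rfl fun _ _ => Finset.sum_congr rfl fun _ _ => by ring

end Evaluation

/-! ### Convolution invertibility of the identity map into the crossed product -/

section Cleaving

open HopfAlgebra

variable {k H : Type*} [Field k] [Ring H] [HopfAlgebra k H]

theorem comm_mul (s t : H ⊗[k] H) : TensorProduct.comm k H H (s * t) =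
    TensorProduct.comm k H H s * TensorProduct.comm k H H t :=
  map_mul (Algebra.TensorProduct.comm k H H) s t

/-- By the action law, starting from `1 · E⁻¹` instead of `1` cancels a factor `E`; with `E` the
cocycle, or its flip, only the antipode identity remains. -/
theorem sandwich_sandwich_mul {s : H →ₗ[k] H} (hs : ∀ x y, s (x * y) = s y * s x)
    {E D W : H ⊗[k] H} (hD : D * E = 1) {c : k} (hW : sandwich s 1 W = c • (1 : H)) :
    sandwich s (sandwich s 1 D) (E * W) = c • (1 : H) := by
  rw [← sandwich_mul hs, ← mul_assoc, hD, one_mul, hW]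

/-- The map `f ↦ f(s(·) v)` on `H^*`. -/
def precompMul (s : H →ₗ[k] H) (v : H) : HopfDual k H →ₗ[k] HopfDual k H :=
  (toDual k H).symm.toLinearMap ∘ₗ LinearMap.lcomp k k (LinearMap.mulRight k v ∘ₗ s) ∘ₗ
    (toDual k H).toLinearMap

@[simp]
theorem precompMul_apply (s : H →ₗ[k] H) (v x : H) (f : HopfDual k H) :
    precompMul s v f x = f (s x * v) := rfl

variable [Module.Finite k H]

theorem sum_dualPairing_right_precompMul (s : H →ₗ[k] H) (v : H) {f : HopfDual k H} {ι : Type*}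
    (r : Repr k f ι) (W : H ⊗[k] H) :
    ∑ i ∈ r.index, dualPairing k H (r.right i ⊗ₜ precompMul s v (r.left i)) W =
      f (sandwich s v W) := by
  induction W with
  | zero => simp
  | add a b ha hb => simp only [map_add, Finset.sum_add_distrib, ha, hb]
  | tmul x y =>
    rw [sandwich_tmul, ← mul_assoc, ← dualPairing_comul, ← r.eq]
    simp [mul_comm]

theorem sum_dualPairing_precompMul_right (s : H →ₗ[k] H) (v : H) {f : HopfDual k H} {ι : Type*}
    (r : Repr k f ι) (W : H ⊗[k] H) :
    ∑ i ∈ r.index, dualPairing k H (precompMul s v (r.left i) ⊗ₜ r.right i) W =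
      f (sandwich s v (TensorProduct.comm k H H W)) := by
  rw [← sum_dualPairing_right_precompMul s v r]
  refine Finset.sum_congr rfl fun i _ => ?_
  induction W with
  | zero => simp
  | add a b ha hb => simp only [map_add, ha, hb]
  | tmul x y => simp [mul_comm]

variable {C : (H ⊗[k] H)ˣ} (hC : IsTwoCocycle (evalTensor (C : H ⊗[k] H)))

theorem toCrossed_mul_apply (f g : HopfDual k H) (x : H) :
    (toCrossed hC).symm (toCrossed hC f * toCrossed hC g) x =
      dualPairing k H (f ⊗ₜ g) ((C : H ⊗[k] H) * comul x) := by
  rw [toCrossed_mul, LinearEquiv.symm_apply_apply, crossedMul_evalTensor_apply]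

theorem CrossedProduct.ext {a b : CrossedProduct hC}
    (h : ∀ x, (toCrossed hC).symm a x = (toCrossed hC).symm b x) : a = b :=
  (toCrossed hC).symm.injective (HopfDual.ext h)

instance : Module.Finite k (CrossedProduct hC) := Module.Finite.equiv (toCrossed hC)

/-- With `D = C⁻¹` and `v = ∑ S(D⁽¹⁾) D⁽²⁾`, the inverse is `f ↦ f(S(-) v)`: its product with `γ` at
`f`, evaluated at `x`, is `f` of `∑ S(C⁽¹⁾ x₁) v C⁽²⁾ x₂ = ε(x)`. -/
theorem isUnit_toCrossed : IsUnit (toConv (toCrossed hC).toLinearMap) := by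
  refine isUnit_of_convMul_eq_one (f := toConv ((toCrossed hC).toLinearMap ∘ₗ
    precompMul (antipode k) (sandwich (antipode k) 1
      (TensorProduct.comm k H H ((C⁻¹ : (H ⊗[k] H)ˣ) : H ⊗[k] H))))) ?_
  refine WithConv.ofConv_injective (LinearMap.ext fun f => CrossedProduct.ext hC fun x => ?_)
  rw [(ℛ k f).convMul_apply]
  simp only [map_sum, LinearMap.sum_apply, comp_apply, LinearEquiv.coe_coe, toCrossed_mul_apply,
    sum_dualPairing_precompMul_right]
  rw [comm_mul, sandwich_sandwich_mul antipode_mul_antidistrib (by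
    rw [← comm_mul, Units.inv_mul, Algebra.TensorProduct.one_def, TensorProduct.comm_tmul])
    (sandwich_antipode_comm_comul x)]
  simp [Algebra.algebraMap_eq_smul_one, toCrossed_one, mul_comm]

/-- Reversing the product pairs `f₂` with the first leg, so the expression to collapse is `∑ T(C⁽²⁾
x₂) v C⁽¹⁾ x₁`. This calls for a skew antipode `T`, and `v = ∑ T(D⁽²⁾) D⁽¹⁾` with `D = C⁻¹`. -/
theorem isUnit_op_toCrossed {R : H ⊗[k] H} (hR : IsRMatrix R) :
    IsUnit (toConv ((MulOpposite.opLinearEquiv k).toLinearMap ∘ₗ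
      (toCrossed hC).toLinearMap)) := by
  obtain ⟨T, hT, hTc⟩ := exists_skew_antipode hR
  refine isUnit_of_convMul_eq_one (f := toConv ((MulOpposite.opLinearEquiv k).toLinearMap ∘ₗ
    (toCrossed hC).toLinearMap ∘ₗ
      precompMul T (sandwich T 1 ((C⁻¹ : (H ⊗[k] H)ˣ) : H ⊗[k] H)))) ?_
  refine WithConv.ofConv_injective (LinearMap.ext fun f =>
    (MulOpposite.opLinearEquiv k).symm.injective (CrossedProduct.ext hC fun x => ?_))
  rw [(ℛ k f).convMul_apply]
  simp only [map_sum, LinearMap.sum_apply, comp_apply, LinearEquiv.coe_coe,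
    MulOpposite.coe_opLinearEquiv, ← MulOpposite.op_mul, MulOpposite.coe_opLinearEquiv_symm,
    MulOpposite.unop_op, toCrossed_mul_apply, sum_dualPairing_right_precompMul]
  rw [sandwich_sandwich_mul hT C.inv_mul (hTc x)]
  simp [Algebra.algebraMap_eq_smul_one, toCrossed_one, mul_comm]

end Cleaving

/-! ### Factorization of the Azumaya maps through `θ` -/

section Main

variable {k H : Type*} [Field k] [Ring H] [HopfAlgebra k H]

theorem theta_add (Q Q' : H ⊗[k] H) : theta (Q + Q') = theta Q + theta Q' := by
  ext f
  simp [theta]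

theorem leftTranslate_zero : leftTranslate (0 : H) = (0 : HopfDual k H →ₗ[k] _) := by
  ext f x
  simp

theorem leftTranslate_add (h h' : H) :
    leftTranslate (h + h') = (leftTranslate h + leftTranslate h' : HopfDual k H →ₗ[k] _) := by
  ext f x
  simp [add_mul]

theorem leftTranslate_smul (c : k) (h : H) :
    leftTranslate (c • h) = c • (leftTranslate h : HopfDual k H →ₗ[k] _) := by
  ext f x
  simp

/-- Flipping `Q` transposes `theta Q`, which is why the conditions from `F` and `G` coincide. -/
theorem theta_comm_apply (Q : H ⊗[k] H) (f g : HopfDual k H) :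
    f (theta (TensorProduct.comm k H H Q) g) = g (theta Q f) := by
  induction Q with
  | zero => simp [theta]
  | add a b ha hb =>
    simp only [theta, map_add, LinearMap.comp_apply, LinearMap.add_apply] at *
    rw [ha, hb]
  | tmul x y => simp [mul_comm]

theorem theta_comm_bijective [Module.Finite k H] {Q : H ⊗[k] H} (h : Function.Bijective (theta Q)) :
    Function.Bijective (theta (TensorProduct.comm k H H Q)) := by
  have hi : Function.Injective (theta (TensorProduct.comm k H H Q)) := by
    rw [injective_iff_map_eq_zero]
    intro g hg
    ext x
    obtain ⟨f, rfl⟩ := h.2 x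
    rw [← theta_comm_apply, hg]
    simp
  -- The assumed bijection itself shows that `H^*` and `H` have equal dimension, so injectivity
  -- suffices.
  have e : Module.finrank k (HopfDual k H) = Module.finrank k H :=
    (LinearEquiv.ofBijective _ h).finrank_eq
  exact ⟨hi, (LinearMap.injective_iff_surjective_of_finrank_eq_finrank e).1 hi⟩

theorem theta_comm_bijective_iff [Module.Finite k H] (Q : H ⊗[k] H) :
    Function.Bijective (theta (TensorProduct.comm k H H Q)) ↔ Function.Bijective (theta Q) := by
  refine ⟨fun h => ?_, theta_comm_bijective⟩
  have := theta_comm_bijective h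
  rwa [← LinearEquiv.trans_apply, TensorProduct.comm_trans_comm, LinearEquiv.refl_apply] at this

variable [Module.Finite k H]

/-- For `Q = p ⊗ q` this is `f(p y) = ∑ f₁(p) f₂(y)`: the leg `p` is absorbed by `f₁` and `q`
translates `g`. -/
theorem sum_dualPairing_right_leftTranslate (Q W : H ⊗[k] H) {f : HopfDual k H} {ι : Type*}
    (r : Repr k f ι) (g : HopfDual k H) :
    ∑ i ∈ r.index, dualPairing k H
      (r.right i ⊗ₜ leftTranslate (theta (TensorProduct.comm k H H Q) (r.left i)) g) W =
        dualPairing k H (f ⊗ₜ g) (Q * W) := by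
  induction Q with
  | zero => simp [theta, leftTranslate_zero]
  | add a b ha hb =>
    simp only [map_add, theta_add, LinearMap.add_apply, leftTranslate_add, tmul_add,
      add_mul, Finset.sum_add_distrib, ha, hb]
  | tmul p q =>
    induction W with
    | zero => simp
    | add a b ha hb => simp only [map_add, mul_add, Finset.sum_add_distrib, ha, hb]
    | tmul y z =>
      rw [Algebra.TensorProduct.tmul_mul_tmul, dualPairing_tmul, ← dualPairing_comul f, ← r.eq]
      simp [leftTranslate_smul, Finset.sum_mul]
      exact Finset.sum_congr rfl fun _ _ => by ring

theorem sum_dualPairing_leftTranslate_right (Q W : H ⊗[k] H) {f : HopfDual k H} {ι : Type*}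
    (r : Repr k f ι) (g : HopfDual k H) :
    ∑ i ∈ r.index, dualPairing k H (leftTranslate (theta Q (r.left i)) g ⊗ₜ r.right i) W =
        dualPairing k H (g ⊗ₜ f) (Q * W) := by
  induction Q with
  | zero => simp [theta, leftTranslate_zero]
  | add a b ha hb =>
    simp only [map_add, theta_add, LinearMap.add_apply, leftTranslate_add, add_tmul,
      add_mul, Finset.sum_add_distrib, ha, hb]
  | tmul p q =>
    induction W with
    | zero => simp
    | add a b ha hb => simp only [map_add, mul_add, Finset.sum_add_distrib, ha, hb]
    | tmul y z =>
      rw [Algebra.TensorProduct.tmul_mul_tmul, dualPairing_tmul, ← dualPairing_comul f, ← r.eq]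
      simp [leftTranslate_smul, Finset.mul_sum]
      exact Finset.sum_congr rfl fun _ _ => by ring

variable {C : (H ⊗[k] H)ˣ} (hC : IsTwoCocycle (evalTensor (C : H ⊗[k] H)))

theorem dualPairing_dualAct_dualAct (r s : H) (f g : HopfDual k H) (W : H ⊗[k] H) :
    dualPairing k H (dualAct s g ⊗ₜ dualAct r f) W =
      dualPairing k H (f ⊗ₜ g) (TensorProduct.comm k H H W * r ⊗ₜ s) := by
  induction W with
  | zero => simp
  | add a b ha hb => simp only [map_add, add_mul, ha, hb]
  | tmul x y => simp [dualAct_apply, mul_comm]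

theorem opMul_toCrossed_apply {R : H ⊗[k] H} (hR : IsRMatrix R) (f g : HopfDual k H) (x : H) :
    (toCrossed hC).symm (opMul (CrossedProduct hC) R (toCrossed hC f) (toCrossed hC g)) x =
      dualPairing k H (f ⊗ₜ g) (twistedR R C * ((C : H ⊗[k] H) * comul x)) := by
  -- Induction over pure tensors needs an arbitrary `S`, since the R-matrix axioms do not pass to
  -- summands of `R`.
  have key : ∀ S : H ⊗[k] H,
      (toCrossed hC).symm (opMul (CrossedProduct hC) S (toCrossed hC f) (toCrossed hC g)) x =
        dualPairing k H (f ⊗ₜ g) (TensorProduct.comm k H H ((C : H ⊗[k] H) * comul x) * S) := by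
    intro S
    induction S with
    | zero => simp [opMul]
    | add a b ha hb =>
      simp only [opMul, map_add, LinearMap.comp_add, LinearMap.add_apply, mul_add,
        TensorProduct.curry_apply, LinearMap.comp_apply] at *
      rw [ha, hb]
    | tmul r s =>
      rw [opMul_tmul, smul_toCrossed, smul_toCrossed, toCrossed_mul_apply,
        dualPairing_dualAct_dualAct]
  -- `τ(C) τΔ(x) R = τ(C) R Δ(x) = (τ(C) R C⁻¹) C Δ(x)`.
  rw [key, comm_mul, mul_assoc, hR.comm_comul_mul, twistedR]
  simp only [mul_assoc, Units.inv_mul_cancel_left]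

theorem opMul_toCrossed_eq_sum_left {R : H ⊗[k] H} (hR : IsRMatrix R) {f : HopfDual k H}
    {ι : Type*} (r : Repr k f ι) (g : HopfDual k H) :
    opMul (CrossedProduct hC) R (toCrossed hC f) (toCrossed hC g) =
      ∑ i ∈ r.index, toCrossed hC (r.right i) * toCrossed hC
        (leftTranslate (theta (TensorProduct.comm k H H (twistedR R C)) (r.left i)) g) := by
  refine CrossedProduct.ext hC fun x => ?_
  rw [opMul_toCrossed_apply hC hR, ← sum_dualPairing_right_leftTranslate _ _ r]
  simp only [map_sum, LinearMap.sum_apply, toCrossed_mul_apply]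

theorem opMul_toCrossed_eq_sum_right {R : H ⊗[k] H} (hR : IsRMatrix R) {f : HopfDual k H}
    {ι : Type*} (r : Repr k f ι) (g : HopfDual k H) :
    opMul (CrossedProduct hC) R (toCrossed hC g) (toCrossed hC f) =
      ∑ i ∈ r.index, toCrossed hC (leftTranslate (theta (twistedR R C) (r.left i)) g) *
        toCrossed hC (r.right i) := by
  refine CrossedProduct.ext hC fun x => ?_
  rw [opMul_toCrossed_apply hC hR, ← sum_dualPairing_leftTranslate_right _ _ r]
  simp only [map_sum, LinearMap.sum_apply, toCrossed_mul_apply]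

instance : Nontrivial (CrossedProduct hC) := by
  refine ⟨1, 0, fun h => ?_⟩
  have := congr((toCrossed hC).symm $h (1 : H))
  rw [toCrossed_one, LinearEquiv.symm_apply_apply] at this
  simp at this

/-- A nonzero vector space is faithfully flat. -/
theorem rTensor_bijective_iff_of_field {M N P : Type*} [AddCommGroup M] [Module k M]
    [AddCommGroup N] [Module k N] [AddCommGroup P] [Module k P] [Nontrivial M] {f : N →ₗ[k] P} :
    Function.Bijective (f.rTensor M) ↔ Function.Bijective f := by
  rw [← Module.FaithfullyFlat.lTensor_bijective_iff_bijective k M f, Function.Bijective,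
    Function.Bijective, LinearMap.lTensor_inj_iff_rTensor_inj,
    LinearMap.lTensor_surj_iff_rTensor_surj]

theorem azumayaF_toCrossed_bijective_iff {R : H ⊗[k] H} (hR : IsRMatrix R) :
    Function.Bijective (azumayaF (CrossedProduct hC) R) ↔
      Function.Bijective (theta (TensorProduct.comm k H H (twistedR R C))) := by
  let A := CrossedProduct hC
  let o : A ≃ₗ[k] Aᵐᵒᵖ := MulOpposite.opLinearEquiv k
  let θ := theta (TensorProduct.comm k H H (twistedR R C))
  -- `F(a # b̄)(c) = ∑ a b₂ · c(θ(b₁) -)`: here `b` is comultiplied and `b₂` multiplies `a` from the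
  -- right, hence the swap of factors and the passage to `Aᵐᵒᵖ` for the Galois map.
  let e : A ⊗[k] A ≃ₗ[k] HopfDual k H ⊗[k] Aᵐᵒᵖ :=
    TensorProduct.comm k A A ≪≫ₗ TensorProduct.congr (toCrossed hC).symm o
  let e' : H ⊗[k] Aᵐᵒᵖ ≃ₗ[k] H ⊗[k] A := TensorProduct.congr (.refl k H) o.symm
  let e'' : (HopfDual k H →ₗ[k] A) ≃ₗ[k] Module.End k A :=
    LinearEquiv.arrowCongr (toCrossed hC) (.refl k A)
  have key : azumayaF A R = e''.toLinearMap ∘ₗ convEval (toCrossed hC).toLinearMap ∘ₗ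
      e'.toLinearMap ∘ₗ θ.rTensor Aᵐᵒᵖ ∘ₗ
        galoisMap (o.toLinearMap ∘ₗ (toCrossed hC).toLinearMap) ∘ₗ e.toLinearMap := by
    ext a b c
    obtain ⟨b, rfl⟩ := (toCrossed hC).surjective b
    obtain ⟨c, rfl⟩ := (toCrossed hC).surjective c
    simp [e, e', e'', o, A, galoisMap_repr _ (ℛ k b), convEval_tmul,
      opMul_toCrossed_eq_sum_left hC hR (ℛ k b), Finset.mul_sum, mul_assoc, θ,
      LinearEquiv.arrowCongr_apply]
  rw [key]
  have h1 := galoisMap_bijective (isUnit_op_toCrossed hC hR)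
  have h2 := convEval_bijective (isUnit_toCrossed hC)
  simp only [LinearMap.coe_comp, LinearEquiv.coe_coe]
  rw [e''.bijective.of_comp_iff', h2.of_comp_iff', e'.bijective.of_comp_iff',
    (h1.comp e.bijective).of_comp_iff, rTensor_bijective_iff_of_field]

theorem azumayaG_toCrossed_bijective_iff {R : H ⊗[k] H} (hR : IsRMatrix R) :
    Function.Bijective (azumayaG (CrossedProduct hC) R) ↔
      Function.Bijective (theta (twistedR R C)) := by
  let A := CrossedProduct hC
  let o : A ≃ₗ[k] Aᵐᵒᵖ := MulOpposite.opLinearEquiv k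
  let θ := theta (twistedR R C)
  -- `G(ā # b)(c) = ∑ c(θ(a₁) -) · a₂ b`: the Galois map now lives in `A`, while `c` is multiplied
  -- from the left, so the last convolution takes place in `Aᵐᵒᵖ`.
  let e : A ⊗[k] A ≃ₗ[k] HopfDual k H ⊗[k] A := TensorProduct.congr (toCrossed hC).symm (.refl k A)
  let e' : H ⊗[k] A ≃ₗ[k] H ⊗[k] Aᵐᵒᵖ := TensorProduct.congr (.refl k H) o
  let e'' : (HopfDual k H →ₗ[k] Aᵐᵒᵖ) ≃ₗ[k] Module.End k A :=
    LinearEquiv.arrowCongr (toCrossed hC) o.symm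
  have key : azumayaG A R = e''.toLinearMap ∘ₗ
      convEval (o.toLinearMap ∘ₗ (toCrossed hC).toLinearMap) ∘ₗ
        e'.toLinearMap ∘ₗ θ.rTensor A ∘ₗ
          galoisMap (toCrossed hC).toLinearMap ∘ₗ e.toLinearMap := by
    ext a b c
    obtain ⟨a, rfl⟩ := (toCrossed hC).surjective a
    obtain ⟨c, rfl⟩ := (toCrossed hC).surjective c
    simp [e, e', e'', o, A, galoisMap_repr _ (ℛ k a), convEval_tmul,
      opMul_toCrossed_eq_sum_right hC hR (ℛ k a), Finset.sum_mul, mul_assoc, θ,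
      LinearEquiv.arrowCongr_apply]
  rw [key]
  have h1 := galoisMap_bijective (isUnit_toCrossed hC)
  have h2 := convEval_bijective (isUnit_op_toCrossed hC hR)
  simp only [LinearMap.coe_comp, LinearEquiv.coe_coe] at h2 ⊢
  rw [e''.bijective.of_comp_iff', h2.of_comp_iff', e'.bijective.of_comp_iff',
    (h1.comp e.bijective).of_comp_iff, rTensor_bijective_iff_of_field]

end Main

end HopfAzumaya
end

open HopfAzumaya
theorem corollary2p6 {k : Type*} {H : Type*} [Field k] [Ring H] [HopfAlgebra k H]
    [Module.Finite k H] (R : H ⊗[k] H) (hR : IsRMatrix R) (C : (H ⊗[k] H)ˣ)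
    (hC : IsTwoCocycle (evalTensor (C : H ⊗[k] H))) :
    IsBraidedAzumaya (CrossedProduct hC) R ↔ Function.Bijective (theta (twistedR R C)) := by
  have hF := azumayaF_toCrossed_bijective_iff hC hR
  have hG := azumayaG_toCrossed_bijective_iff hC hR
  rw [theta_comm_bijective_iff] at hF
  exact ⟨fun h => hF.1 h.bijective_F, fun h => ⟨hF.2 h, hG.2 h⟩⟩
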